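/- Let $\kappa$ be a measurable cardinal, that is, an uncountable cardinal such that there is a nonprincipal $\kappa$-complete ultrafilter on $\kappa$, and let $\lambda$ be a cardinal with $\kappa<\lambda$. Then, for every set $I$ of cardinality $\lambda$ (in particular for $I=\lambda$), there is an ultrafilter $\mathcal D$ on $I$ such that: 1. $\mathcal D$ is regular: there is a family $\langle X_i : i<\lambda\rangle$ of members of $\mathcal D$ such that $\bigcap_{i\in\sigma}X_i=\emptyset$ for every infinite $\sigma\subseteq\lambda$; 2. $\mathcal D$ is $\lambda$-flexible: for every $f:I\to\mathbb N$ such that $\{t\in I : n<f(t)\}\in\mathcal D$ for all $n\in\mathbb N$, there are $X_\alpha\in\mathcal D$ for $\alpha<\lambda$ such that $|\{\alpha<\lambda : t\in X_\alpha\}|\le f(t)$ for all $t\in I$; 3. $\mathcal D$ is not $\kappa^{++}$-good. Here $\mathcal D$ is called $\mu^+$-good if for every $f:[\mu]^{<\aleph_0}\to\mathcal D$ there is $g:[\mu]^{<\aleph_0}\to\mathcal D$ such that $g(u)\subseteq f(u)$ and $g(u)\cap g(v)=g(u\cup v)$ for all finite $u,v\subseteq\mu$; the assertion is that this fails for $\mu=\kappa^+$.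 -/

import Mathlib

open Cardinal

universe u

namespace FlexNotGood

/-- `κ` is a measurable cardinal: it is uncountable and the set `κ` carries a nonprincipal
`κ`-complete ultrafilter (closed under intersections of fewer than `κ` of its members). -/
def IsMeasurableCardinal (κ : Cardinal.{u}) : Prop :=
  ℵ₀ < κ ∧ ∃ E : Ultrafilter κ.ord.ToType,
    CardinalInterFilter (E : Filter κ.ord.ToType) κ ∧ ∀ a, E ≠ pure a

/-- The filter `D` on `I` is `μ`-regular: there is a family `⟨X i : i < μ⟩` of members of `D`
such that the intersection of any infinitely many (distinct indices) of them is empty.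
When `#I = μ` this is what "regular" means. -/
def IsRegularFilter {I : Type u} (D : Filter I) (μ : Cardinal.{u}) : Prop :=
  ∃ X : μ.ord.ToType → Set I, (∀ i, X i ∈ D) ∧
    ∀ σ : Set μ.ord.ToType, σ.Infinite → ⋂ i ∈ σ, X i = ∅

/-- The filter `D` on `I` is `μ`-flexible: for every `f : I → ℕ` which is `D`-nonstandard
(`n < f` modulo `D` for every `n`), there are `X α ∈ D` for `α < μ` such that
`|{α : t ∈ X α}| ≤ f t` for all `t`. -/
def IsFlexible {I : Type u} (D : Filter I) (μ : Cardinal.{u}) : Prop :=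
  ∀ f : I → ℕ, (∀ n : ℕ, {t | n < f t} ∈ D) →
    ∃ X : μ.ord.ToType → Set I, (∀ α, X α ∈ D) ∧
      ∀ t : I, #{α : μ.ord.ToType | t ∈ X α} ≤ (f t : Cardinal.{u})

/-- The filter `D` on `I` is `μ⁺`-good (note the successor): every map `f` from the finite subsets
of `μ` to `D` has a multiplicative refinement `g` from the finite subsets of `μ` to `D`. -/
def IsSuccGood {I : Type u} (D : Filter I) (μ : Cardinal.{u}) : Prop :=
  ∀ f : Finset μ.ord.ToType → Set I, (∀ u, f u ∈ D) →
    ∃ g : Finset μ.ord.ToType → Set I, (∀ u, g u ∈ D) ∧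
      (∀ u, g u ⊆ f u) ∧ ∀ u v, g u ∩ g v = g (u ∪ v)

end FlexNotGood

/-! The ultrafilter is a product of the measurable ultrafilter `E` on `κ` with a regular flexible
ultrafilter on a set `K` of size `λ`. Regularity is inherited from the second factor; flexibility is
proved column by column, countable completeness of `E` making a nonstandard `f` nonstandard in
almost every column.

The factor on `K` comes from a recursion of length `2^λ` through all `f : K → ℕ`, starting from
`2^λ` independent functions into the finite subsets of `λ`. Each stage uses up finitely many of them
and either bounds `f` or adds the sets that flexibility asks of it (`IndepMod.exists_settled`).

Goodness fails since, given injections `e b` of each `b < κ⁺` into `κ`, a multiplicative refinement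
of the sets "first coordinate above `e b a`" would cover `κ⁺` by `κ` sets of size at most `κ`
(`not_isSuccGood_prodUltrafilter`). -/

namespace FlexNotGood

open Filter Set

/-! ### Filters with independent families, and the recursion -/

section Independence

variable {W K V : Type u}

/-- The set of points at which the functions `e w`, `w ∈ s`, take the prescribed values `a w`. -/
def cylinder (e : W → K → V) (s : Finset W) (a : W → V) : Set K := {t | ∀ w ∈ s, e w t = a w}

/-- The family `e` restricted to `Rᶜ` is independent modulo the filter `D`: each cylinder given by
finitely many functions outside `R` meets each member of `D`. -/
def IndepMod (e : W → K → V) (D : Filter K) (R : Set W) : Prop :=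
  ∀ (s : Finset W) (a : W → V), (∀ w ∈ s, w ∉ R) → ∀ A ∈ D, (A ∩ cylinder e s a).Nonempty

theorem IndepMod.neBot {e : W → K → V} {D : Filter K} {R : Set W} [Nonempty V]
    (h : IndepMod e D R) : D.NeBot := by
  refine forall_mem_nonempty_iff_neBot.1 fun A hA => ?_
  exact (h ∅ (fun _ => Classical.arbitrary V) (by simp) A hA).mono inter_subset_left

theorem mem_inf_iInf_principal {ι : Type*} {D : Filter K} {X : ι → Set K} {A : Set K} :
    A ∈ D ⊓ ⨅ i, 𝓟 (X i) → ∃ B ∈ D, ∃ s : Finset ι, B ∩ ⋂ i ∈ s, X i ⊆ A := by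
  intro hA
  obtain ⟨B, hB, C, hC, rfl⟩ := mem_inf_iff.1 hA
  obtain ⟨s, hs⟩ := (mem_iInf_finite _).1 hC
  refine ⟨B, hB, s, inter_subset_inter_right _ ?_⟩
  rw [iInf_principal_finset] at hs
  exact hs

variable {L : Type u}

/-- `f` is bounded modulo `D`, or `D` contains sets `X α` for `α : L`, at most `f t` of them
containing any given point `t`. -/
def Settled (L : Type u) (D : Filter K) (f : K → ℕ) : Prop :=
  (∃ n, {t | f t ≤ n} ∈ D) ∨
    ∃ X : L → Set K, (∀ α, X α ∈ D) ∧ ∀ t, #{α | t ∈ X α} ≤ (f t : Cardinal.{u})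

theorem Settled.mono {D D' : Filter K} {f : K → ℕ} (h : Settled L D f) (hD : D' ≤ D) :
    Settled L D' f := by
  rcases h with ⟨n, hn⟩ | ⟨X, hX, hc⟩
  · exact Or.inl ⟨n, hD hn⟩
  · exact Or.inr ⟨X, fun α => hD (hX α), hc⟩

theorem IndepMod.inf_principal_cylinder {e : W → K → V} {D : Filter K} {R : Set W}
    (h : IndepMod e D R) (s : Finset W) (a : W → V) (hs : ∀ w ∈ s, w ∉ R) :
    IndepMod e (D ⊓ 𝓟 (cylinder e s a)) (R ∪ s) := by
  classical
  intro v b hv A hA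
  rw [mem_inf_principal] at hA
  obtain ⟨t, ht, htc⟩ := h (s ∪ v) (fun w => if w ∈ s then a w else b w) (by
    intro w hw
    rcases Finset.mem_union.1 hw with hw | hw
    · exact hs w hw
    · exact fun hR => hv w hw (Or.inl hR)) _ hA
  refine ⟨t, ht fun w hw => ?_, fun w hw => ?_⟩
  · simpa [hw] using htc w (Finset.mem_union_left _ hw)
  · have hws : w ∉ s := fun hws => hv w hw (Or.inr hws)
    simpa [hws] using htc w (Finset.mem_union_right _ hw)

/-- Adding to `D` sets `X α` such that, modulo `D`, `e w t = s` implies `t ∈ X α` for all `α ∈ s`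
keeps the functions other than `e w` independent. -/
theorem IndepMod.inf_iInf_principal {e : W → K → Finset L} {D : Filter K} {R : Set W}
    (h : IndepMod e D R) {w : W} (hw : w ∉ R) {X : L → Set K}
    (hX : ∀ s : Finset L, {t | e w t = s → ∀ α ∈ s, t ∈ X α} ∈ D) :
    IndepMod e (D ⊓ ⨅ α : L, 𝓟 (X α)) (R ∪ {w}) := by
  classical
  intro v b hv A hA
  obtain ⟨B, hB, s, hs⟩ := mem_inf_iInf_principal hA
  obtain ⟨t, ⟨htB, htX⟩, htc⟩ := h (insert w v) (Function.update b w s) (by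
    intro x hx
    rcases Finset.mem_insert.1 hx with rfl | hx
    · exact hw
    · exact fun hR => hv x hx (Or.inl hR)) _ (inter_mem hB (hX s))
  have hwt : e w t = s := by simpa using htc w (Finset.mem_insert_self _ _)
  refine ⟨t, hs ⟨htB, mem_iInter₂.2 (htX hwt)⟩, fun x hx => ?_⟩
  have hxw : x ≠ w := fun hxw => hv x hx (Or.inr hxw)
  simpa [hxw] using htc x (Finset.mem_insert_of_mem hx)

/-- If forcing `f` to be nonstandard preserves independence, one fresh function supplies the sets `X
α`. Otherwise some cylinder witnesses the failure, and adding that cylinder bounds `f`. -/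
theorem IndepMod.exists_settled {e : W → K → Finset L} {D : Filter K} {R : Set W}
    (h : IndepMod e D R) (hR : R ≠ Set.univ) (f : K → ℕ) :
    ∃ D' ≤ D, ∃ s : Finset W, IndepMod e D' (R ∪ s) ∧ Settled L D' f := by
  by_cases hf : IndepMod e (D ⊓ ⨅ n : ℕ, 𝓟 {t | n ≤ f t}) R
  · obtain ⟨w, hw⟩ := (ne_univ_iff_exists_notMem R).1 hR
    -- The cardinality clause gives the counting bound at every point; it costs nothing modulo a
    -- filter making `f` nonstandard.
    let X : L → Set K := fun α => {t | α ∈ e w t ∧ (e w t).card ≤ f t}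
    refine ⟨(D ⊓ ⨅ n : ℕ, 𝓟 {t | n ≤ f t}) ⊓ ⨅ α, 𝓟 (X α), inf_le_left.trans inf_le_left, {w},
      ?_, Or.inr ⟨X, fun α => mem_inf_of_right (mem_iInf_of_mem α (mem_principal_self _)),
        fun t => ?_⟩⟩
    · rw [Finset.coe_singleton]
      refine hf.inf_iInf_principal hw fun s => ?_
      filter_upwards [mem_inf_of_right (mem_iInf_of_mem s.card (mem_principal_self _))]
        with t ht hts α hα
      exact ⟨hts ▸ hα, hts ▸ ht⟩
    · by_cases hc : (e w t).card ≤ f t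
      · calc #{α | t ∈ X α}
            ≤ #(e w t : Set L) := mk_le_mk_of_subset fun α hα => hα.1
          _ = ((e w t).card : Cardinal) := by simp
          _ ≤ f t := by exact_mod_cast hc
      · have : {α | t ∈ X α} = ∅ := by
          ext α; simp [X, hc]
        rw [this]; simp
  · unfold IndepMod at hf
    push Not at hf
    obtain ⟨s, a, hs, A, hA, hempty⟩ := hf
    refine ⟨D ⊓ 𝓟 (cylinder e s a), inf_le_left, s, h.inf_principal_cylinder s a hs, Or.inl ?_⟩
    obtain ⟨B, hB, v, hv⟩ := mem_inf_iInf_principal hA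
    -- On `B` within the cylinder, `f` fails some `n ≤ f t` with `n ∈ v`, so it lies below the
    -- maximum of `v`.
    refine ⟨v.sup id, ?_⟩
    rw [mem_inf_principal]
    filter_upwards [hB] with t htB htc
    by_contra hlt
    simp only [not_le] at hlt
    refine (eq_empty_iff_forall_notMem.1 hempty t) ⟨hv ⟨htB, ?_⟩, htc⟩
    simp only [mem_iInter]
    intro n hn
    exact (Finset.le_sup (f := id) hn).trans hlt.le

/-- Settling a sequence of functions indexed by a well-order each of whose proper initial segments
is too small to use up the independent family. -/
theorem IndepMod.exists_forall_settled [LinearOrder W] [WellFoundedLT W] {e : W → K → Finset L}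
    {D₀ : Filter K} {R₀ : Finset W} (h : IndepMod e D₀ R₀)
    (hW : ∀ (w : W) (ρ : W → Finset W), ↑R₀ ∪ ⋃ y ∈ Iio w, (ρ y : Set W) ≠ Set.univ)
    (f : W → K → ℕ) :
    ∃ D ≤ D₀, D.NeBot ∧ ∀ w, Settled L D (f w) := by
  have step : ∀ (D : Filter K) (R : Set W) (g : K → ℕ), ∃ p : Filter K × Finset W, p.1 ≤ D ∧
      (IndepMod e D R → R ≠ Set.univ → IndepMod e p.1 (R ∪ p.2) ∧ Settled L p.1 g) := by
    intro D R g
    by_cases hD : IndepMod e D R ∧ R ≠ Set.univ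
    · obtain ⟨D', hD', s, hs⟩ := hD.1.exists_settled hD.2 g
      exact ⟨(D', s), hD', fun _ _ => hs⟩
    · exact ⟨(D, ∅), le_rfl, fun h₁ h₂ => absurd ⟨h₁, h₂⟩ hD⟩
  choose F hFle hF using step
  let r : W → Filter K × Finset W := wellFounded_lt.fix fun w prev =>
    F (D₀ ⊓ ⨅ y : Iio w, (prev y y.2).1) (↑R₀ ∪ ⋃ y : Iio w, ((prev y y.2).2 : Set W)) (f w)
  let Dlt : Set W → Filter K := fun S => D₀ ⊓ ⨅ y : S, (r y).1
  let Rlt : Set W → Set W := fun S => ↑R₀ ∪ ⋃ y : S, ((r y).2 : Set W)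
  have hr : ∀ w, r w = F (Dlt (Iio w)) (Rlt (Iio w)) (f w) := fun w => wellFounded_lt.fix_eq _ w
  have hle : ∀ w, (r w).1 ≤ Dlt (Iio w) := fun w => by rw [hr w]; exact hFle _ _ _
  have hle₀ : ∀ w, (r w).1 ≤ D₀ := fun w => (hle w).trans inf_le_left
  have hanti : Antitone fun w => (r w).1 := by
    intro y w hyw
    rcases hyw.eq_or_lt with rfl | hlt
    · exact le_rfl
    · exact (hle w).trans (inf_le_right.trans (iInf_le (fun y : Iio w => (r y).1) ⟨y, hlt⟩))
  -- The filters decrease, so a member of the infimum already belongs to one stage, whose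
  -- independence applies.
  have hlim : ∀ S : Set W, (∀ y ∈ S, Iio y ⊆ S) →
      (∀ y ∈ S, IndepMod e (r y).1 (Rlt (Iio y) ∪ (r y).2)) → IndepMod e (Dlt S) (Rlt S) := by
    intro S hS hind s a hs A hA
    rcases S.eq_empty_or_nonempty with rfl | hne
    · refine h s a (fun w hw hR => hs w hw (Or.inl hR)) A ?_
      simpa [Dlt] using hA
    · have := hne.to_subtype
      have hDS : Dlt S = ⨅ y : S, (r y).1 :=
        inf_eq_right.2 ((iInf_le _ (Classical.arbitrary S)).trans (hle₀ _))
      rw [hDS, mem_iInf_of_directed] at hA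
      · obtain ⟨y, hy⟩ := hA
        refine hind y y.2 s a (fun w hw hR => hs w hw ?_) A hy
        rcases hR with (hR | hR) | hR
        · exact Or.inl hR
        · obtain ⟨z, hz⟩ := mem_iUnion.1 hR
          exact Or.inr (mem_iUnion.2 ⟨⟨z, hS y y.2 z.2⟩, hz⟩)
        · exact Or.inr (mem_iUnion.2 ⟨y, hR⟩)
      · intro x y
        rcases le_total x.1 y.1 with hxy | hxy
        · exact ⟨y, hanti hxy, le_rfl⟩
        · exact ⟨x, le_rfl, hanti hxy⟩
  have key : ∀ w, IndepMod e (r w).1 (Rlt (Iio w) ∪ (r w).2) ∧ Settled L (r w).1 (f w) := by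
    intro w
    induction w using WellFoundedLT.induction with
    | ind w ih =>
      have h₁ : IndepMod e (Dlt (Iio w)) (Rlt (Iio w)) :=
        hlim _ (fun y hy => Iio_subset_Iio (le_of_lt hy)) fun y hy => (ih y hy).1
      have h₂ : Rlt (Iio w) ≠ Set.univ := by
        have := hW w fun y => (r y).2
        rwa [biUnion_eq_iUnion] at this
      rw [hr w]
      exact hF _ _ _ h₁ h₂
  refine ⟨Dlt Set.univ, inf_le_left, (hlim Set.univ (fun _ _ => subset_univ _) fun y _ => (key y).1).neBot,
    fun w => (key w).2.mono ?_⟩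
  exact inf_le_right.trans (iInf_le (fun y : (Set.univ : Set W) => (r y).1) ⟨w, mem_univ w⟩)

end Independence

/-! ### An independent family of size `2^λ` on a set of size `λ` -/

section IndependentFamily

variable (L : Type u)

/-- The independent family of functions indexed by the subsets of `L`. -/
noncomputable def tableLookup [DecidableEq L] (A : Set L) (t : Finset L × Finset (Finset L × L)) : Finset L :=
  open scoped Classical in (t.2.filter fun p => p.1 = t.1.filter (· ∈ A)).image Prod.snd

/-- A finite `S` separates the members of `s`, so a finite table keyed by the traces `A ∩ S` can
store all the prescribed values. -/
theorem exists_tableLookup_eq [DecidableEq L] [Nonempty L] (s : Finset (Set L)) (a : Set L → Finset L) :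
    ∃ t, ∀ A ∈ s, tableLookup L A t = a A := by
  classical
  have hsep : ∀ A B : Set L, ∃ x, A ≠ B → ¬(x ∈ A ↔ x ∈ B) := by
    intro A B
    by_contra! h
    obtain ⟨x⟩ := ‹Nonempty L›
    exact (h x).1 (Set.ext fun y => (h y).2)
  choose d hd using hsep
  let S : Finset L := (s ×ˢ s).image fun p => d p.1 p.2
  have hS : ∀ A ∈ s, ∀ B ∈ s, S.filter (· ∈ A) = S.filter (· ∈ B) → A = B := by
    intro A hA B hB hAB
    by_contra hne
    have hmem : d A B ∈ S :=
      Finset.mem_image.2 ⟨(A, B), Finset.mem_product.2 ⟨hA, hB⟩, rfl⟩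
    have := congrArg (d A B ∈ ·) hAB
    simp only [Finset.mem_filter, hmem, true_and, eq_iff_iff] at this
    exact hd A B hne this
  refine ⟨(S, s.biUnion fun A => (a A).image fun x => (S.filter (· ∈ A), x)), fun A hA => ?_⟩
  ext x
  simp only [tableLookup, Finset.mem_image, Finset.mem_filter, Finset.mem_biUnion]
  constructor
  · rintro ⟨p, ⟨⟨B, hB, y, hy, rfl⟩, hp⟩, rfl⟩
    have := hS B hB A hA (by convert hp)
    exact this ▸ hy
  · intro hx
    exact ⟨(S.filter (· ∈ A), x), ⟨⟨A, hA, x, hx, rfl⟩, by congr⟩, rfl⟩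

end IndependentFamily

/-! ### Existence of a regular flexible ultrafilter -/

theorem mk_Iio_ord_lt {c : Cardinal.{u}} (i : c.ord.ToType) : #(Iio i) < c := by
  simpa using mk_Iio_lt i (by simp)

/-- On some set of size `lam` there is a `lam`-regular `lam`-flexible ultrafilter. -/
theorem exists_regular_flexible_ultrafilter (lam : Cardinal.{u}) (hlam : ℵ₀ ≤ lam) :
    ∃ (K : Type u) (_ : #K = lam) (D : Ultrafilter K),
      IsRegularFilter (D : Filter K) lam ∧ IsFlexible (D : Filter K) lam := by
  classical
  let L := lam.ord.ToType
  have hL : #L = lam := mk_ord_toType lam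
  have : Infinite L := infinite_iff.2 (hL ▸ hlam)
  let K := Finset L × Finset (Finset L × L)
  have hK : #K = lam := by
    simp [K, mk_finset_of_infinite, hL, mul_eq_self hlam]
  let W := (2 ^ lam : Cardinal.{u}).ord.ToType
  have hW : #W = 2 ^ lam := mk_ord_toType _
  have hWinf : ℵ₀ < #W := hW ▸ hlam.trans_lt (cantor lam)
  obtain ⟨φ⟩ : Nonempty (W ≃ Set L) := Cardinal.eq.1 (by rw [hW, mk_set, hL])
  obtain ⟨ψ⟩ : Nonempty (W ≃ (K → ℕ)) := Cardinal.eq.1 (by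
    rw [hW, mk_pi, prod_const, hK]
    simp [power_eq_two_power hlam (ofNat_lt_aleph0 (n := 2)).le hlam])
  let e : W → K → Finset L := fun w => tableLookup L (φ w)
  have he : IndepMod e ⊤ ((∅ : Finset W) : Set W) := by
    intro s a _ A hA
    obtain ⟨t, ht⟩ := exists_tableLookup_eq L (s.image φ) (fun A => a (φ.symm A))
    refine ⟨t, by simp [mem_top.1 hA], fun w hw => ?_⟩
    simpa using ht (φ w) (Finset.mem_image_of_mem _ hw)
  obtain ⟨w₀⟩ : Nonempty W := mk_ne_zero_iff.1 (aleph0_pos.trans hWinf).ne'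
  let D₀ : Filter K := ⨅ α : L, 𝓟 {t | α ∈ e w₀ t}
  have hD₀ : IndepMod e D₀ (({w₀} : Finset W) : Set W) := by
    have := he.inf_iInf_principal (w := w₀) (X := fun α => {t | α ∈ e w₀ t}) (by simp)
      fun s => univ_mem' fun t ht α hα => by subst ht; exact hα
    simpa using this
  obtain ⟨D, hD, hne, hset⟩ := hD₀.exists_forall_settled (fun w ρ h => by
    -- Fewer than `2^λ` stages, each using finitely many functions, cannot exhaust the family.
    have hlt : #(Iio w) * ℵ₀ < #W :=
      mul_lt_of_lt hWinf.le ((mk_Iio_ord_lt w).trans_eq hW.symm) hWinf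
    have h₁ : #(⋃ y ∈ Iio w, (ρ y : Set W) : Set W) < #W := by
      refine ((mk_biUnion_le _ _).trans (mul_le_mul_right ?_ _)).trans_lt hlt
      exact ciSup_le' fun y => (lt_aleph0_iff_finite.2 (ρ y).finite_toSet).le
    have h₂ : #((({w₀} : Finset W) : Set W) ∪ ⋃ y ∈ Iio w, (ρ y : Set W) : Set W) < #W :=
      (mk_union_le _ _).trans_lt (add_lt_of_lt hWinf.le
        ((lt_aleph0_iff_finite.2 (Finset.finite_toSet _)).trans hWinf) h₁)
    rw [h, mk_univ] at h₂
    exact h₂.false) ψ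
  refine ⟨K, hK, Ultrafilter.of D, ⟨fun α => {t | α ∈ e w₀ t}, fun α => ?_, fun σ hσ => ?_⟩,
    fun f hf => ?_⟩
  · exact (Ultrafilter.of_le D) (hD (mem_iInf_of_mem α (mem_principal_self _)))
  · refine eq_empty_iff_forall_notMem.2 fun t ht => hσ ?_
    refine (e w₀ t).finite_toSet.subset fun α hα => ?_
    exact mem_iInter₂.1 ht α hα
  · obtain ⟨w, rfl⟩ := ψ.surjective f
    rcases (hset w).mono (Ultrafilter.of_le D) with ⟨n, hn⟩ | h
    · exfalso
      obtain ⟨t, ht₁, ht₂⟩ := Filter.nonempty_of_mem (inter_mem hn (hf n))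
      exact Nat.not_lt.2 ht₁ ht₂
    · exact h

/-! ### Regularity and flexibility of products -/

section Product

variable {A B I : Type u}

/-- The image under `φ : A × B ≃ I` of the product of ultrafilters `E` on `A` and `D` on `B`. -/
noncomputable def prodUltrafilter (E : Ultrafilter A) (D : Ultrafilter B) (φ : A × B ≃ I) :
    Ultrafilter I :=
  E.bind fun a => D.map fun b => φ (a, b)

theorem mem_prodUltrafilter {E : Ultrafilter A} {D : Ultrafilter B} {φ : A × B ≃ I} {X : Set I} :
    X ∈ (prodUltrafilter E D φ : Filter I) ↔ {a | {b | φ (a, b) ∈ X} ∈ D} ∈ E :=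
  Iff.rfl

theorem IsRegularFilter.prodUltrafilter {D : Ultrafilter B} {μ : Cardinal.{u}}
    (h : IsRegularFilter (D : Filter B) μ) (E : Ultrafilter A) (φ : A × B ≃ I) :
    IsRegularFilter (prodUltrafilter E D φ : Filter I) μ := by
  obtain ⟨X, hX, hσ⟩ := h
  refine ⟨fun i => {t | (φ.symm t).2 ∈ X i}, fun i => ?_, fun σ hinf => ?_⟩
  · rw [mem_prodUltrafilter]
    filter_upwards with a
    simpa using hX i
  · refine eq_empty_iff_forall_notMem.2 fun t ht => ?_
    refine eq_empty_iff_forall_notMem.1 (hσ σ hinf) (φ.symm t).2 ?_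
    simpa using ht

theorem IsFlexible.prodUltrafilter {D : Ultrafilter B} {μ : Cardinal.{u}}
    (h : IsFlexible (D : Filter B) μ) (E : Ultrafilter A) [CountableInterFilter (E : Filter A)]
    (φ : A × B ≃ I) : IsFlexible (prodUltrafilter E D φ : Filter I) μ := by
  intro f hf
  let T : Set A := {a | ∀ n : ℕ, {b | n < f (φ (a, b))} ∈ D}
  have hT : T ∈ (E : Filter A) :=
    (eventually_countable_forall (l := (E : Filter A))
      (p := fun a n => {b | n < f (φ (a, b))} ∈ D)).2 fun n => hf n
  have hX : ∀ a, ∃ X : μ.ord.ToType → Set B, (a ∈ T → ∀ α, X α ∈ (D : Filter B)) ∧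
      ∀ b, #{α | b ∈ X α} ≤ (f (φ (a, b)) : Cardinal.{u}) := by
    intro a
    by_cases ha : a ∈ T
    · obtain ⟨X, hX⟩ := h (fun b => f (φ (a, b))) ha
      exact ⟨X, fun _ => hX.1, hX.2⟩
    -- Empty sets on the exceptional columns keep the counting bound valid everywhere.
    · exact ⟨fun _ => ∅, fun h => absurd h ha, by simp⟩
  choose X hXD hXc using hX
  refine ⟨fun α => {t | (φ.symm t).2 ∈ X (φ.symm t).1 α}, fun α => ?_, fun t => ?_⟩
  · rw [mem_prodUltrafilter]
    filter_upwards [hT] with a ha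
    simpa using hXD a ha α
  · simpa using hXc (φ.symm t).1 (φ.symm t).2

end Product

/-! ### Failure of goodness -/

section NotGood

variable {κ : Cardinal.{u}}

theorem eventually_lt_of_nonprincipal {E : Ultrafilter κ.ord.ToType} (hκ : ℵ₀ ≤ κ)
    [CardinalInterFilter (E : Filter κ.ord.ToType) κ] (hE : ∀ a, E ≠ pure a) (c : κ.ord.ToType) :
    {t | c < t} ∈ (E : Filter κ.ord.ToType) := by
  have hc : #(Iic c) < κ := by
    rw [← Iio_insert]
    exact mk_insert_le.trans_lt
      (add_lt_of_lt hκ (mk_Iio_ord_lt c) (one_lt_aleph0.trans_le hκ))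
  have hne : ∀ a, ({a}ᶜ : Set κ.ord.ToType) ∈ (E : Filter κ.ord.ToType) := by
    intro a
    refine Ultrafilter.compl_mem_iff_notMem.2 fun ha => hE a ?_
    exact Ultrafilter.coe_le_coe.1 (le_pure_iff.2 ha)
  have := (cardinal_bInter_mem hc).2 fun a (_ : a ∈ Iic c) => hne a
  filter_upwards [this] with t ht
  by_contra hlt
  exact mem_iInter₂.1 ht t (not_lt.1 hlt) rfl

/-- A set of ordinals below `κ⁺` each of whose initial segments has size less than `κ` has size
at most `κ`. -/
theorem mk_le_of_forall_inter_Iio_lt (hκ : ℵ₀ ≤ κ) (S : Set (Order.succ κ).ord.ToType)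
    (hS : ∀ b ∈ S, #(S ∩ Iio b : Set (Order.succ κ).ord.ToType) < κ) : #S ≤ κ := by
  by_contra! hlt
  -- A subset `S'` of size `κ` is bounded by some `b ∈ S`, which then has `κ` predecessors in `S`.
  obtain ⟨S', hS', hcard⟩ := le_mk_iff_exists_subset.1 hlt.le
  have hU : #(⋃ b ∈ S', Iic b) ≤ κ := by
    refine (mk_biUnion_le _ _).trans ?_
    rw [hcard]
    refine (mul_le_mul_right (ciSup_le' fun b => ?_) κ).trans (mul_eq_self hκ).le
    rw [← Iio_insert]
    refine mk_insert_le.trans (add_le_of_le hκ ?_ (one_le_aleph0.trans hκ))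
    exact Order.lt_succ_iff.1 (mk_Iio_ord_lt _)
  obtain ⟨b, hb, hbU⟩ : ∃ b ∈ S, b ∉ ⋃ b ∈ S', Iic b := by
    by_contra! h
    exact (hlt.trans_le (mk_le_mk_of_subset h)).not_ge hU
  refine (hS b hb).not_ge (hcard.symm.le.trans (mk_le_mk_of_subset fun x hx => ⟨hS' hx, ?_⟩))
  by_contra hlt
  exact hbU (mem_iUnion₂.2 ⟨x, hx, mem_Iic.2 (not_lt.1 hlt)⟩)

/-- The product of a uniform ultrafilter on `κ` and any ultrafilter is not `κ⁺⁺`-good. -/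
theorem not_isSuccGood_prodUltrafilter {B I : Type u} (hκ : ℵ₀ ≤ κ)
    {E : Ultrafilter κ.ord.ToType} (hE : ∀ c, {t | c < t} ∈ (E : Filter κ.ord.ToType))
    (D : Ultrafilter B) (φ : κ.ord.ToType × B ≃ I) :
    ¬ IsSuccGood (prodUltrafilter E D φ : Filter I) (Order.succ κ) := by
  intro hgood
  let M := (Order.succ κ).ord.ToType
  have hinj : ∀ b : M, Nonempty (Iio b ↪ κ.ord.ToType) := fun b => by
    rw [← Cardinal.le_def, mk_ord_toType]
    exact Order.lt_succ_iff.1 (mk_Iio_ord_lt b)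
  let e := fun b => (hinj b).some
  obtain ⟨g, hgD, hgf, hg⟩ := hgood
    (fun s => ⋂ b ∈ s, ⋂ a ∈ s, {t | ∀ h : a < b, e b ⟨a, h⟩ < (φ.symm t).1}) (by
      intro s
      refine (Filter.biInter_finset_mem s).2 fun b _ => (Filter.biInter_finset_mem s).2 fun a _ => ?_
      by_cases h : a < b
      · rw [mem_prodUltrafilter]
        filter_upwards [hE (e b ⟨a, h⟩)] with t ht
        exact univ_mem' fun x _ => by simpa using ht
      · exact univ_mem' fun x hab => absurd hab h)
  have hτ : ∀ a : M, ∃ t, {x | φ (t, x) ∈ g {a}} ∈ D := fun a =>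
    Filter.nonempty_of_mem (mem_prodUltrafilter.1 (hgD {a}))
  choose τ hτ using hτ
  have hfib : ∀ t, #(τ ⁻¹' {t}) ≤ κ := by
    intro t
    refine mk_le_of_forall_inter_Iio_lt hκ _ fun b hb => ?_
    refine lt_of_le_of_lt ?_ (mk_Iio_ord_lt t)
    -- In column `t` both `g {a}` and `g {b}` are large, so they meet; multiplicativity puts a
    -- common point in `g {a, b}`. Hence `e b` injects the earlier part of the fibre into `Iio t`.
    have hlt : ∀ a ∈ τ ⁻¹' {t}, ∀ h : a < b, e b ⟨a, h⟩ < t := by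
      intro a ha h
      have h₁ := hτ a
      have h₂ := hτ b
      rw [ha] at h₁
      rw [hb] at h₂
      obtain ⟨x, hxa, hxb⟩ := Ultrafilter.nonempty_of_mem (inter_mem h₁ h₂)
      have hx : φ (t, x) ∈ g ({a} ∪ {b}) := hg {a} {b} ▸ ⟨hxa, hxb⟩
      have := mem_iInter₂.1 (mem_iInter₂.1 (hgf _ hx) b (by simp)) a (by simp) h
      simpa using this
    refine mk_le_of_injective (f := fun a : ↥(τ ⁻¹' {t} ∩ Iio b) =>
      (⟨e b ⟨a, a.2.2⟩, hlt a a.2.1 a.2.2⟩ : Iio t)) fun x y hxy => ?_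
    have := (e b).injective (congrArg Subtype.val hxy)
    exact Subtype.ext (Subtype.mk.inj this)
  have := mk_le_mk_mul_of_mk_preimage_le τ hfib
  rw [mk_ord_toType, mk_ord_toType, mul_eq_self hκ] at this
  exact this.not_gt (Order.lt_succ κ)

end NotGood

end FlexNotGood

theorem theorem7p10 (κ lam : Cardinal.{u}) (hκ : FlexNotGood.IsMeasurableCardinal κ)
    (hlam : κ < lam) (I : Type u) (hI : Cardinal.mk I = lam) :
    ∃ D : Ultrafilter I,
      FlexNotGood.IsRegularFilter (D : Filter I) lam ∧
      FlexNotGood.IsFlexible (D : Filter I) lam ∧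
      -- `D` is not `κ⁺⁺`-good, where `κ⁺⁺` is the successor of `κ⁺`
      ¬ FlexNotGood.IsSuccGood (D : Filter I) (Order.succ κ) := by
  obtain ⟨hκ₀, E, hEκ, hE⟩ := hκ
  obtain ⟨K, hK, D, hreg, hflex⟩ :=
    FlexNotGood.exists_regular_flexible_ultrafilter lam (hκ₀.trans hlam).le
  obtain ⟨φ⟩ : Nonempty (κ.ord.ToType × K ≃ I) := Cardinal.eq.1 (by
    rw [mk_prod, lift_id, lift_id, mk_ord_toType, hK, hI]
    exact mul_eq_right (hκ₀.trans hlam).le hlam.le (aleph0_pos.trans hκ₀).ne')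
  have := CardinalInterFilter.toCountableInterFilter (E : Filter κ.ord.ToType) hκ₀
  exact ⟨FlexNotGood.prodUltrafilter E D φ, hreg.prodUltrafilter E φ, hflex.prodUltrafilter E φ,
    FlexNotGood.not_isSuccGood_prodUltrafilter hκ₀.le
      (FlexNotGood.eventually_lt_of_nonprincipal hκ₀.le hE) D φ⟩
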